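/- Let $\mathbb{F}$ be a finite field of prime order. For integers $n, d \ge 0$ let $\mathcal{P}_d(\mathbb{F}^n)$ be the set of polynomials of degree at most $d$ on $\mathbb{F}^n$, that is, of functions $P : \mathbb{F}^n \to \mathbb{F}$ with $D_{h_1} \cdots D_{h_{d+1}} P = 0$ for all $h_1, \dots, h_{d+1} \in \mathbb{F}^n$, where $D_h P(x) := P(x+h) - P(x)$. Let $k \ge 0$ and $0 \le d < |\mathbb{F}|$ be integers. Then there is a constant $C$, depending only on $\mathbb{F}$, $d$ and $k$ (in particular not on $n$), such that the following holds for every $n \ge 0$. Let $P_1, \dots, P_k \in \mathcal{P}_d(\mathbb{F}^n)$, and let $Q \in \mathcal{P}_d(\mathbb{F}^n)$ be such that $Q(x) = 0$ for every $x \in \mathbb{F}^n$ with $P_1(x) = \dots = P_k(x) = 0$. Then there exist polynomials $R_1, \dots, R_k \in \mathcal{P}_C(\mathbb{F}^n)$ such that $$ Q(x) = P_1(x) R_1(x) + \dots + P_k(x) R_k(x) \qquad \text{for all } x \in \mathbb{F}^n. $$ -/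

import Mathlib

/-- The iterated additive derivative `D_{h₁} ⋯ D_{hₘ} P` of a function `P : Fⁿ → F` along the list of
shifts `h₁, …, hₘ`, where `D_h P(x) = P(x + h) - P(x)` is Mathlib's `fwdDiff h P`. -/
def iterAddDeriv {F : Type*} [Field F] {n : ℕ} (hs : List (Fin n → F)) (P : (Fin n → F) → F) :
    (Fin n → F) → F :=
  hs.foldr (fun h f => fwdDiff h f) P

/-- The space `𝒫_d(Fⁿ)` of polynomials of degree at most `d` on `Fⁿ`: the functions `P : Fⁿ → F` with
`D_{h₁} ⋯ D_{h_{d+1}} P = 0` for all `h₁, …, h_{d+1} ∈ Fⁿ`. -/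
def polyDegLE (F : Type*) [Field F] (n d : ℕ) : Set ((Fin n → F) → F) :=
  {P | ∀ h : Fin (d + 1) → (Fin n → F), iterAddDeriv (List.ofFn h) P = 0}

/-! By Fermat, `1 - P i ^ (|F| - 1)` is the indicator of `P i = 0`, so the hypothesis says `Q * ∏ i,
(1 - P i ^ (|F| - 1)) = 0`. Expanding the product in order and pulling one `P i` out of each term
gives explicit `R i` (`eq_sum_mul_of_forall_eq_zero`). Degrees add under products
(`VanishesUnder.mul`), so the bound is free of `n`. -/

/-- `VanishesUnder m P` says that all `m`-fold additive derivatives of `P` are zero. -/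
def VanishesUnder {F : Type*} [Field F] {n : ℕ} (m : ℕ) (P : (Fin n → F) → F) : Prop :=
  ∀ hs : List (Fin n → F), hs.length = m → iterAddDeriv hs P = 0

section

variable {F : Type*} [Field F] {n : ℕ}

theorem mem_polyDegLE_iff {d : ℕ} {P : (Fin n → F) → F} :
    P ∈ polyDegLE F n d ↔ VanishesUnder (d + 1) P := by
  constructor
  · rintro hP hs hlen
    have := hP (fun i => hs.get (i.cast hlen.symm))
    rwa [show List.ofFn (fun i : Fin (d + 1) => hs.get (i.cast hlen.symm)) = hs from
      List.ext_getElem (by rw [List.length_ofFn, hlen]) fun i _ _ => by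
        rw [List.getElem_ofFn]; rfl] at this
  · intro hP h
    exact hP _ (List.length_ofFn)

theorem vanishesUnder_zero_iff {P : (Fin n → F) → F} : VanishesUnder 0 P ↔ P = 0 := by
  constructor
  · intro h
    exact h [] rfl
  · rintro rfl hs hlen
    obtain rfl := List.length_eq_zero_iff.mp hlen
    rfl

theorem vanishesUnder_succ_iff {m : ℕ} {P : (Fin n → F) → F} :
    VanishesUnder (m + 1) P ↔ ∀ h, VanishesUnder m (fwdDiff h P) := by
  constructor
  · intro hP h hs hlen
    simpa [iterAddDeriv] using hP (hs ++ [h]) (by simp [hlen])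
  · intro hP hs hlen
    rcases List.eq_nil_or_concat hs with rfl | ⟨l, h, rfl⟩
    · simp at hlen
    · simpa [iterAddDeriv] using hP h l (by simpa using hlen)

theorem VanishesUnder.zero (m : ℕ) : VanishesUnder m (0 : (Fin n → F) → F) := by
  induction m with
  | zero => exact vanishesUnder_zero_iff.mpr rfl
  | succ m ih =>
    refine vanishesUnder_succ_iff.mpr fun h => ?_
    rwa [show fwdDiff h (0 : (Fin n → F) → F) = 0 by ext x; simp [fwdDiff]]

theorem VanishesUnder.add {m : ℕ} {P Q : (Fin n → F) → F} (hP : VanishesUnder m P)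
    (hQ : VanishesUnder m Q) : VanishesUnder m (P + Q) := by
  induction m generalizing P Q with
  | zero =>
    rw [vanishesUnder_zero_iff] at *
    simp [hP, hQ]
  | succ m ih =>
    rw [vanishesUnder_succ_iff] at *
    intro h
    rw [fwdDiff_add]
    exact ih (hP h) (hQ h)

theorem VanishesUnder.neg {m : ℕ} {P : (Fin n → F) → F} (hP : VanishesUnder m P) :
    VanishesUnder m (-P) := by
  induction m generalizing P with
  | zero =>
    rw [vanishesUnder_zero_iff] at *
    simp [hP]
  | succ m ih =>
    rw [vanishesUnder_succ_iff] at *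
    intro h
    rw [show fwdDiff h (-P) = -fwdDiff h P by ext x; simp [fwdDiff]; ring]
    exact ih (hP h)

/-- The Leibniz rule for additive derivatives. -/
theorem fwdDiff_mul_eq (h : Fin n → F) (P Q : (Fin n → F) → F) :
    fwdDiff h (P * Q) = fwdDiff h P * Q + P * fwdDiff h Q + fwdDiff h P * fwdDiff h Q := by
  ext x
  simp only [fwdDiff, Pi.mul_apply, Pi.add_apply]
  ring

/-- Each term of the Leibniz rule lowers `a` or `b` by one, which drives the induction on `N`. The
`+ 1` arises because degree `d` means vanishing under `d + 1` derivatives. -/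
theorem VanishesUnder.mul {N a b : ℕ} {P Q : (Fin n → F) → F} (hP : VanishesUnder a P)
    (hQ : VanishesUnder b Q) (hab : a + b ≤ N + 1) : VanishesUnder N (P * Q) := by
  induction N generalizing a b P Q with
  | zero =>
    obtain rfl | rfl : a = 0 ∨ b = 0 := by omega
    · simpa [vanishesUnder_zero_iff.mp hP] using VanishesUnder.zero _
    · simpa [vanishesUnder_zero_iff.mp hQ] using VanishesUnder.zero _
  | succ N ih =>
    rcases a with _ | a
    · simpa [vanishesUnder_zero_iff.mp hP] using VanishesUnder.zero _
    rcases b with _ | b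
    · simpa [vanishesUnder_zero_iff.mp hQ] using VanishesUnder.zero _
    refine vanishesUnder_succ_iff.mpr fun h => ?_
    have hP' := vanishesUnder_succ_iff.mp hP h
    have hQ' := vanishesUnder_succ_iff.mp hQ h
    rw [fwdDiff_mul_eq]
    exact ((ih hP' hQ (by omega)).add (ih hP hQ' (by omega))).add (ih hP' hQ' (by omega))

theorem one_mem_polyDegLE_zero : (1 : (Fin n → F) → F) ∈ polyDegLE F n 0 := by
  refine mem_polyDegLE_iff.mpr (vanishesUnder_succ_iff.mpr fun h => ?_)
  exact vanishesUnder_zero_iff.mpr (by ext x; simp [fwdDiff])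

theorem mul_mem_polyDegLE {a b : ℕ} {P Q : (Fin n → F) → F} (hP : P ∈ polyDegLE F n a)
    (hQ : Q ∈ polyDegLE F n b) : P * Q ∈ polyDegLE F n (a + b) := by
  rw [mem_polyDegLE_iff] at *
  exact hP.mul hQ (by omega)

theorem polyDegLE_mono {a b : ℕ} (hab : a ≤ b) : polyDegLE F n a ⊆ polyDegLE F n b := by
  intro P hP
  have h1 := one_mem_polyDegLE_zero (F := F) (n := n)
  rw [mem_polyDegLE_iff] at *
  simpa using hP.mul (N := b + 1) h1 (by omega)

theorem one_sub_mem_polyDegLE {a : ℕ} {P : (Fin n → F) → F} (hP : P ∈ polyDegLE F n a) :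
    1 - P ∈ polyDegLE F n a := by
  have h1 := polyDegLE_mono a.zero_le (one_mem_polyDegLE_zero (F := F) (n := n))
  rw [mem_polyDegLE_iff] at *
  simpa [sub_eq_add_neg] using h1.add hP.neg

theorem prod_mem_polyDegLE {ι : Type*} {a : ℕ} (s : Finset ι) {P : ι → (Fin n → F) → F}
    (hP : ∀ i ∈ s, P i ∈ polyDegLE F n a) : ∏ i ∈ s, P i ∈ polyDegLE F n (s.card * a) := by
  classical
  induction s using Finset.induction_on with
  | empty => simpa using one_mem_polyDegLE_zero
  | insert i s hi ih =>
    rw [Finset.prod_insert hi, Finset.card_insert_of_notMem hi, add_one_mul, add_comm]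
    exact mul_mem_polyDegLE (hP i (by simp)) (ih fun j hj => hP j (by simp [hj]))

theorem pow_mem_polyDegLE {a : ℕ} {P : (Fin n → F) → F} (hP : P ∈ polyDegLE F n a) (m : ℕ) :
    P ^ m ∈ polyDegLE F n (m * a) := by
  simpa using prod_mem_polyDegLE (Finset.range m) (P := fun _ => P) fun _ _ => hP

/-- If a nonzero value `q` forces some `p i` to be nonzero, then `q` is a combination of the `p i`
with explicit coefficients, each of them a polynomial in `q` and the `p j`. -/
theorem eq_sum_mul_of_forall_eq_zero [Fintype F] {k : ℕ} (p : Fin k → F) (q : F)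
    (hq : (∀ i, p i = 0) → q = 0) :
    q = ∑ i, p i * (q * p i ^ (Fintype.card F - 2) *
      ∏ j with j < i, (1 - p j ^ (Fintype.card F - 1))) := by
  have hcard : Fintype.card F - 1 = Fintype.card F - 2 + 1 := by
    have := Fintype.one_lt_card (α := F)
    omega
  have hzero : q * ∏ i, (1 - p i ^ (Fintype.card F - 1)) = 0 := by
    by_cases hp : ∀ i, p i = 0
    · simp [hq hp]
    · obtain ⟨i, hi⟩ := not_forall.mp hp
      rw [Finset.prod_eq_zero (Finset.mem_univ i), mul_zero]
      rw [FiniteField.pow_card_sub_one_eq_one _ hi, sub_self]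
  -- Telescoping: `∏ i, (1 - a i) = 1 - ∑ i, a i * ∏ j < i, (1 - a j)`.
  rw [Finset.prod_one_sub_ordered, mul_sub, mul_one, sub_eq_zero, Finset.mul_sum] at hzero
  conv_lhs => rw [hzero]
  refine Finset.sum_congr rfl fun i _ => ?_
  conv_lhs => rw [hcard, pow_succ, ← hcard]
  ring

end

theorem mainTheorem8 {F : Type*} [Field F] [Fintype F] (hF : (Fintype.card F).Prime)
    (k d : ℕ) (hd : d < Fintype.card F) :
    ∃ C : ℕ, ∀ (n : ℕ) (P : Fin k → (Fin n → F) → F) (Q : (Fin n → F) → F),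
      (∀ i, P i ∈ polyDegLE F n d) → Q ∈ polyDegLE F n d →
      (∀ x : Fin n → F, (∀ i, P i x = 0) → Q x = 0) →
      ∃ R : Fin k → (Fin n → F) → F,
        (∀ i, R i ∈ polyDegLE F n C) ∧ ∀ x : Fin n → F, Q x = ∑ i, P i x * R i x := by
  set p := Fintype.card F with hp
  -- The summands bound the degrees of `Q`, of `P i ^ (p - 2)`, and of at most `k` factors `1 - P j
  -- ^ (p - 1)`.
  refine ⟨d + (p - 2) * d + k * ((p - 1) * d), fun n P Q hP hQ hPQ => ?_⟩
  refine ⟨fun i => Q * P i ^ (p - 2) * ∏ j with j < i, (1 - P j ^ (p - 1)), fun i => ?_,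
    fun x => ?_⟩
  · refine mul_mem_polyDegLE (mul_mem_polyDegLE hQ (pow_mem_polyDegLE (hP i) _)) ?_
    refine polyDegLE_mono (Nat.mul_le_mul_right _ ?_) (prod_mem_polyDegLE _ fun j _ =>
      one_sub_mem_polyDegLE (pow_mem_polyDegLE (hP j) (p - 1)))
    simpa using Finset.card_le_univ (Finset.univ.filter (· < i))
  · simpa [Finset.prod_apply, hp] using
      eq_sum_mul_of_forall_eq_zero (fun i => P i x) (Q x) (hPQ x)
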